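/- Let $d$ be a positive integer, and let $\mathbb{C}\langle z,z^*\rangle=\mathbb{C}\langle z_1,\dots,z_d,z_1^*,\dots,z_d^*\rangle$ be the algebra of $*$-polynomials in $d$ noncommuting variables. Let $\mathbb{C}_1\langle z,z^*\rangle$ be its subspace of $*$-polynomials of degree at most $1$, i.e. the linear span of $1,z_1,\dots,z_d,z_1^*,\dots,z_d^*$. For $n\in\mathbb{N}$ let $M_n(\cdot)$ denote $n\times n$ matrices with entries in the given space. For a $d$-tuple $x=(x_1,\dots,x_d)$ in a unital C*-algebra $\mathcal{A}$, the evaluation $p(x)$ is obtained by substituting $z_i\mapsto x_i$, $z_i^*\mapsto x_i^*$ (entrywise for matrix-valued $p$), and for $p\in M_n(\mathbb{C}\langle z,z^*\rangle)$ the norm $\|p(x)\|$ is the C*-norm of $M_n(\mathcal{A})$. Let $\mathcal{T}$ be a metric space and $t_0\in\mathcal{T}$. Suppose that for every $t\in\mathcal{T}$ there is a unital C*-algebra $\mathcal{A}_t$ and a $d$-tuple $\xi_t=(\xi_{t,1},\dots,\xi_{t,d})\in\mathcal{A}_t^d$ which generates $\mathcal{A}_t$ as a unital C*-algebra, and suppose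 that all the $\xi_{t,i}$ ($t\in\mathcal{T}$, $i=1,\dots,d$) are unitary. If (iii) $\lim_{t\to t_0}\|p(\xi_t)\|=\|p(\xi_{t_0})\|$ for all $n\in\mathbb{N}$ and all $p\in M_n(\mathbb{C}_1\langle z,z^*\rangle)$, then (i) $\lim_{t\to t_0}\|p(\xi_t)\|=\|p(\xi_{t_0})\|$ for all $p\in\mathbb{C}\langle z,z^*\rangle$, and therefore also (ii) $\lim_{t\to t_0}\|p(\xi_t)\|=\|p(\xi_{t_0})\|$ for all $n\in\mathbb{N}$ and all $p\in M_n(\mathbb{C}\langle z,z^*\rangle)$. -/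

import Mathlib

open Filter Topology

/-- The algebra `ℂ⟨z, z*⟩` of `*`-polynomials in `d` noncommuting variables: the free complex
algebra on the letters `z i` (`Sum.inl i`) and `(z i)*` (`Sum.inr i`). -/
abbrev StarPoly (d : ℕ) : Type := FreeAlgebra ℂ (Fin d ⊕ Fin d)

namespace StarPoly

/-- Evaluation `p ↦ p(x)` of `*`-polynomials at a `d`-tuple `x` of elements of a C*-algebra:
the unital algebra homomorphism with `z i ↦ x i` and `(z i)* ↦ star (x i)`. -/
def eval {d : ℕ} {A : Type*} [CStarAlgebra A] (x : Fin d → A) : StarPoly d →ₐ[ℂ] A :=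
  FreeAlgebra.lift ℂ (Sum.elim x (fun i => star (x i)))

/-- The space `ℂ_k⟨z, z*⟩` of `*`-polynomials of degree at most `k`: the linear span of the words
of length at most `k` in the letters `z i` and `(z i)*`. -/
def degreeLE (d k : ℕ) : Submodule ℂ (StarPoly d) :=
  Submodule.span ℂ
    {w | ∃ l : List (Fin d ⊕ Fin d), l.length ≤ k ∧ w = (l.map (FreeAlgebra.ι ℂ)).prod}

/-- Evaluation of an `n × n` matrix of `*`-polynomials, entry by entry. -/
def matEval {d n : ℕ} {A : Type*} [CStarAlgebra A] (x : Fin d → A)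
    (p : Matrix (Fin n) (Fin n) (StarPoly d)) : Matrix (Fin n) (Fin n) A :=
  p.map (eval x)

end StarPoly

/-- The C*-norm on `M_n(A)` for a unital C*-algebra `A`. Mathlib's norm on `CStarMatrix` asks for
the order of `A`, which is put in here as the canonical one (`a ≤ b` iff `b - a` is positive). -/
noncomputable def matrixCStarNorm {n : ℕ} {A : Type*} [CStarAlgebra A]
    (M : Matrix (Fin n) (Fin n) A) : ℝ :=
  letI : PartialOrder A := CStarAlgebra.spectralOrder A
  letI : StarOrderedRing A := CStarAlgebra.spectralOrderedRing A
  ‖CStarMatrix.ofMatrix M‖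

/-! The idea is to linearise one multiplication by a unitary `u` at a time. For the block matrix `X`
with rows `(a, c)` and `(b, c u*)`, write `X = v + y` with `v` the second column and `y` the first.
Then `v y* = 0` and `v v* = 2c² P`, where `P` is the projection with rows `(1, u)/2` and `(u*,
1)/2`, so `X X* = 2c² P + y y*`. For large `c` the part over `P` dominates, and `‖X‖² - 2c²` is
close to `‖P y‖² = ‖a + u b‖² / 2` (`norm_blocks_estimate`).

Hence if norms of matrices over a space `V ⊇ ℂ₁⟨z, z*⟩` are continuous at `t₀`, so are those over `V
+ g V` for each letter `g` (`sup_map_mulLeft_ι`): the entries of `X` lie in `V`, and the error is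
uniform near `t₀`. Iterating reaches every `*`-polynomial. -/

/-! ### Norm of a large multiple of a projection plus a perturbation. -/

section CStarAlgebra

variable {B : Type*} [CStarAlgebra B]

lemma mul_star_add_of_orthogonal {v y : B} (hvy : v * star y = 0) :
    (v + y) * star (v + y) = v * star v + y * star y := by
  have h : y * star v = 0 := by simpa using congrArg star hvy
  rw [star_add, add_mul, mul_add, mul_add, hvy, h, add_zero, zero_add]

variable [PartialOrder B] [StarOrderedRing B]

/-- Compressing `X X* ≤ ‖X‖²`, for `X = v + y`, by `P` gives `k P + (P y)(P y)* ≤ ‖X‖² P`. -/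
lemma IsStarProjection.add_norm_sq_le {P v y : B} {k : ℝ} (hP : IsStarProjection P) (hP0 : P ≠ 0)
    (hk : 0 ≤ k) (hv : v * star v = k • P) (hvy : v * star y = 0) :
    k + ‖P * y‖ ^ 2 ≤ ‖v + y‖ ^ 2 := by
  have hPs : star P = P := hP.isSelfAdjoint
  have hPP : P * P = P := hP.isIdempotentElem
  have hPn : ‖P‖ = 1 := by
    have h := CStarRing.norm_star_mul_self (x := P)
    rw [hPs, hPP] at h
    have : ‖P‖ ≠ 0 := norm_ne_zero_iff.mpr hP0
    field_simp at h
    exact h.symm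
  have hX := mul_star_add_of_orthogonal hvy
  have hXle : (v + y) * star (v + y) ≤ algebraMap ℝ B (‖v + y‖ ^ 2) :=
    CStarAlgebra.mul_star_le_algebraMap_norm_sq
  have hkle : k ≤ ‖v + y‖ ^ 2 := by
    have h1 : v * star v ≤ (v + y) * star (v + y) := by
      rw [hX]; exact le_add_of_nonneg_right (mul_star_self_nonneg y)
    have h2 := CStarAlgebra.norm_le_norm_of_nonneg_of_le (mul_star_self_nonneg v) h1
    rw [hv, norm_smul, hPn, mul_one, Real.norm_of_nonneg hk, CStarRing.norm_self_mul_star] at h2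
    rwa [pow_two]
  have hc := star_left_conjugate_le_conjugate hXle P
  rw [hX, hv, hPs, Algebra.algebraMap_eq_smul_one] at hc
  have h3 : (P * y) * star (P * y) ≤ (‖v + y‖ ^ 2 - k) • P := by
    have e1 : P * (k • P + y * star y) * P = k • P + (P * y) * star (P * y) := by
      simp only [mul_add, add_mul, mul_smul_comm, smul_mul_assoc, hPP, star_mul, hPs, mul_assoc]
    have e2 : P * ((‖v + y‖ ^ 2) • (1 : B)) * P = (‖v + y‖ ^ 2) • P := by
      simp only [mul_smul_comm, smul_mul_assoc, hPP, mul_one]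
    rw [e1, e2] at hc
    rw [sub_smul]
    exact le_sub_iff_add_le'.mpr hc
  have h4 := CStarAlgebra.norm_le_norm_of_nonneg_of_le (mul_star_self_nonneg _) h3
  rw [norm_smul, hPn, mul_one, Real.norm_of_nonneg (by linarith), CStarRing.norm_self_mul_star,
    ← pow_two] at h4
  linarith

lemma mul_star_add_le {δ : ℝ} (hδ : 0 < δ) (p q : B) :
    (p + q) * star (p + q) ≤ (1 + δ) • (p * star p) + (1 + δ⁻¹) • (q * star q) := by
  have h := mul_star_self_nonneg ((√δ) • p - (√δ)⁻¹ • q)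
  have h1 : √δ * √δ = δ := Real.mul_self_sqrt hδ.le
  have h2 : (√δ)⁻¹ * (√δ)⁻¹ = δ⁻¹ := by rw [← mul_inv, h1]
  have h3 : √δ * (√δ)⁻¹ = 1 := mul_inv_cancel₀ (Real.sqrt_pos.mpr hδ).ne'
  have h4 : (√δ)⁻¹ * √δ = 1 := by rw [mul_comm, h3]
  rw [← sub_nonneg]
  convert h using 1
  simp only [star_sub, star_smul, star_add, sub_mul, mul_sub, add_mul, mul_add, smul_mul_assoc,
    mul_smul_comm, smul_sub, smul_smul, star_trivial, h1, h2, h3, h4, add_smul, one_smul]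
  abel

/-- Splitting `y = P y + (1 - P) y`, the cross terms of `y y*` are absorbed at the cost of factors
`1 + δ` and `1 + δ⁻¹`. The large factor falls only on `1 - P`, where `k P` vanishes and `hy` leaves
room for it. -/
lemma IsStarProjection.norm_sq_le {P v y : B} {k δ : ℝ} (hP : IsStarProjection P)
    (hδ : 0 < δ) (hv : v * star v = k • P) (hvy : v * star y = 0)
    (hy : (1 + δ⁻¹) * ‖y‖ ^ 2 ≤ k) :
    ‖v + y‖ ^ 2 ≤ k + (1 + δ) * ‖P * y‖ ^ 2 := by
  have hPs : star P = P := hP.isSelfAdjoint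
  have hPP : P * P = P := hP.isIdempotentElem
  have hQ : IsStarProjection (1 - P) := hP.one_sub
  have hQs : star (1 - P) = 1 - P := hQ.isSelfAdjoint
  have hQQ : (1 - P) * (1 - P) = 1 - P := hQ.isIdempotentElem
  have hX := mul_star_add_of_orthogonal hvy
  have key : ∀ {R w : B}, star R = R → R * R = R → R * w = w → w * star w ≤ (‖w‖ ^ 2) • R := by
    intro R w hRs hRR hRw
    have := star_left_conjugate_le_conjugate
      (CStarAlgebra.mul_star_le_algebraMap_norm_sq (a := w)) R
    rw [hRs, Algebra.algebraMap_eq_smul_one, mul_smul_comm, smul_mul_assoc, mul_one, hRR,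
      ← mul_assoc, hRw, mul_assoc] at this
    have e : star w * R = star w := by rw [← hRs, ← star_mul, hRw]
    rwa [e] at this
  have hp := key hPs hPP (w := P * y) (by rw [← mul_assoc, hPP])
  have hq := key hQs hQQ (w := (1 - P) * y) (by rw [← mul_assoc, hQQ])
  have hsum := mul_star_add_le hδ (P * y) ((1 - P) * y)
  rw [← add_mul, add_sub_cancel, one_mul] at hsum
  have hqn : ‖(1 - P) * y‖ ≤ ‖y‖ := by
    have h1 : ‖1 - P‖ ≤ 1 := hQ.norm_le
    calc _ ≤ ‖1 - P‖ * ‖y‖ := norm_mul_le _ _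
      _ ≤ 1 * ‖y‖ := by gcongr
      _ = _ := one_mul _
  have hδ' : 0 < δ⁻¹ := inv_pos.mpr hδ
  set m : ℝ := k + (1 + δ) * ‖P * y‖ ^ 2 with hm
  have hk : 0 ≤ k := le_trans (by positivity) hy
  have hm0 : 0 ≤ m := by positivity
  have hle : (v + y) * star (v + y) ≤ algebraMap ℝ B m := by
    calc (v + y) * star (v + y) = k • P + y * star y := by rw [hX, hv]
      _ ≤ k • P + ((1 + δ) • (‖P * y‖ ^ 2 • P) + (1 + δ⁻¹) • (‖(1 - P) * y‖ ^ 2 • (1 - P))) := by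
        refine add_le_add_right (hsum.trans (add_le_add ?_ ?_)) _
        · exact smul_le_smul_of_nonneg_left hp (by positivity)
        · exact smul_le_smul_of_nonneg_left hq (by positivity)
      _ = m • P + ((1 + δ⁻¹) * ‖(1 - P) * y‖ ^ 2) • (1 - P) := by
        rw [hm, add_smul k, smul_smul, smul_smul, add_assoc]
      _ ≤ m • P + m • (1 - P) := by
        refine add_le_add_right (smul_le_smul_of_nonneg_right ?_ hQ.nonneg) _
        calc _ ≤ (1 + δ⁻¹) * ‖y‖ ^ 2 := by gcongr
          _ ≤ k := hy
          _ ≤ m := by rw [hm]; exact le_add_of_nonneg_right (by positivity)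
      _ = algebraMap ℝ B m := by
        rw [← smul_add, add_sub_cancel, Algebra.algebraMap_eq_smul_one]
  have := (CStarAlgebra.norm_le_iff_le_algebraMap _ hm0 (mul_star_self_nonneg _)).mpr hle
  rwa [CStarRing.norm_self_mul_star, ← pow_two] at this

end CStarAlgebra

/-! ### Block matrices and the estimate for `a + u b`. -/

namespace CStarMatrix

section Blocks

variable {n A : Type*}

/-- The `2 × 2` block matrix with the given square blocks. -/
def blocks (a b c d : CStarMatrix n n A) : CStarMatrix (n ⊕ n) (n ⊕ n) A :=
  ofMatrix (Matrix.fromBlocks (ofMatrix.symm a) (ofMatrix.symm b) (ofMatrix.symm c)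
    (ofMatrix.symm d))

lemma blocks_inj {a b c d a' b' c' d' : CStarMatrix n n A} :
    blocks a b c d = blocks a' b' c' d' ↔ a = a' ∧ b = b' ∧ c = c' ∧ d = d' :=
  Matrix.fromBlocks_inj

lemma smul_blocks {R : Type*} [SMul R A] (r : R) (a b c d : CStarMatrix n n A) :
    r • blocks a b c d = blocks (r • a) (r • b) (r • c) (r • d) :=
  Matrix.fromBlocks_smul _ _ _ _ _

variable [CStarAlgebra A]

lemma star_blocks (a b c d : CStarMatrix n n A) :
    star (blocks a b c d) = blocks (star a) (star c) (star b) (star d) :=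
  Matrix.fromBlocks_conjTranspose _ _ _ _

lemma blocks_add_blocks (a b c d a' b' c' d' : CStarMatrix n n A) :
    blocks a b c d + blocks a' b' c' d' = blocks (a + a') (b + b') (c + c') (d + d') :=
  Matrix.fromBlocks_add _ _ _ _ _ _ _ _

lemma blocks_zero : blocks (0 : CStarMatrix n n A) 0 0 0 = 0 :=
  Matrix.fromBlocks_zero

variable [Fintype n]

lemma blocks_mul_blocks (a b c d a' b' c' d' : CStarMatrix n n A) :
    blocks a b c d * blocks a' b' c' d' =
      blocks (a * a' + b * c') (a * b' + b * d') (c * a' + d * c') (c * b' + d * d') :=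
  Matrix.fromBlocks_multiply _ _ _ _ _ _ _ _

variable (n A) in
/-- The inclusion of `M_n(A)` as the upper left corner of `M_{2n}(A)`. -/
def cornerHom : CStarMatrix n n A →⋆ₙₐ[ℂ] CStarMatrix (n ⊕ n) (n ⊕ n) A where
  toFun a := blocks a 0 0 0
  map_smul' r a := by simp [smul_blocks]
  map_zero' := blocks_zero
  map_add' a b := by simp [blocks_add_blocks]
  map_mul' a b := by simp [blocks_mul_blocks]
  map_star' a := by simp [star_blocks]

variable [PartialOrder A] [StarOrderedRing A]

lemma norm_blocks_corner (a : CStarMatrix n n A) : ‖blocks a 0 0 0‖ = ‖a‖ := by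
  classical
  exact NonUnitalStarAlgHom.norm_map (cornerHom n A) (fun a b h ↦ (blocks_inj.mp h).1) a

variable [DecidableEq n]

lemma norm_blocks_estimate {a b u : CStarMatrix n n A} (hu : u ∈ unitary (CStarMatrix n n A))
    {c δ : ℝ} (hδ : 0 < δ) (hc : (1 + δ⁻¹) * ‖blocks a 0 b 0‖ ^ 2 ≤ 2 * c ^ 2) :
    |‖blocks a (c • 1) b (c • star u)‖ ^ 2 - 2 * c ^ 2 * ‖(1 : CStarMatrix n n A)‖
      - ‖a + u * b‖ ^ 2 / 2| ≤ δ * ‖blocks a 0 b 0‖ ^ 2 := by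
  obtain h | h := subsingleton_or_nontrivial (CStarMatrix n n A)
  -- In the zero algebra `‖1‖ = 0`, which is why the statement carries the factor `‖1‖`.
  · have hz : ∀ x : CStarMatrix n n A, x = 0 := fun x ↦ Subsingleton.elim _ _
    rw [hz (a + u * b), hz 1, hz (c • star u), hz (c • 0), hz a, hz b, blocks_zero]
    simp
  have hu1 : star u * u = 1 := (Unitary.mem_iff.mp hu).1
  have hu2 : u * star u = 1 := (Unitary.mem_iff.mp hu).2
  set y := blocks a 0 b 0 with hy
  set v := blocks 0 (c • 1) 0 (c • star u) with hv
  set P := (2⁻¹ : ℝ) • blocks 1 u (star u) 1 with hPdef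
  have hX : blocks a (c • 1) b (c • star u) = v + y := by
    simp [hv, hy, blocks_add_blocks]
  have hP : IsStarProjection P := by
    constructor
    · simp only [IsIdempotentElem, hPdef, smul_mul_assoc, mul_smul_comm, blocks_mul_blocks, hu1,
        hu2, mul_one, one_mul, smul_blocks]
      simp only [← add_smul, smul_smul, blocks_inj]
      norm_num
    · simp [IsSelfAdjoint, hPdef, star_smul, star_blocks]
  have hP0 : P ≠ 0 := by
    rw [hPdef, ← blocks_zero, smul_blocks, Ne, blocks_inj]
    rintro ⟨h1, -⟩
    simp at h1
  have hvv : v * star v = (2 * c ^ 2) • P := by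
    simp only [hv, hPdef, star_blocks, blocks_mul_blocks, smul_blocks, blocks_inj, star_smul,
      star_trivial, star_star, star_one, star_zero, smul_mul_assoc, mul_smul_comm, smul_smul,
      mul_one, one_mul, hu1, mul_zero, zero_add]
    refine ⟨?_, ?_, ?_, ?_⟩ <;> congr 1 <;> ring
  have hvy : v * star y = 0 := by
    simp [hv, hy, star_blocks, blocks_mul_blocks, ← blocks_zero]
  have hPy : ‖P * y‖ ^ 2 = ‖a + u * b‖ ^ 2 / 2 := by
    -- Since `y` lives in the first column, `(P y)* (P y) = y* P y` is supported in one corner.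
    have e : star (P * y) * (P * y) = (2⁻¹ : ℝ) • blocks (star (a + u * b) * (a + u * b)) 0 0 0 := by
      have e1 : star (P * y) * (P * y) = star y * (P * y) := by
        rw [star_mul, hP.isSelfAdjoint.star_eq, mul_assoc, ← mul_assoc P P,
          hP.isIdempotentElem.eq]
      rw [e1]
      simp only [hPdef, hy, star_blocks, blocks_mul_blocks, smul_mul_assoc, mul_smul_comm,
        star_zero, mul_zero, zero_mul, add_zero, one_mul]
      congr 2
      simp only [star_add, star_mul, mul_add, add_mul, mul_assoc]
      rw [← mul_assoc (star u) u, hu1, one_mul]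
      abel
    have e2 : (2⁻¹ : ℝ) • blocks (star (a + u * b) * (a + u * b)) 0 0 0 =
        (2⁻¹ : ℂ) • blocks (star (a + u * b) * (a + u * b)) 0 0 0 := by
      have h : ((2⁻¹ : ℝ) : ℂ) = 2⁻¹ := by norm_num
      rw [← h]
      ext i j
      exact (Complex.coe_smul _ _).symm
    rw [pow_two, ← CStarRing.norm_star_mul_self, e, e2, norm_smul, norm_blocks_corner,
      CStarRing.norm_star_mul_self]
    norm_num
    ring
  have hPyy : ‖P * y‖ ≤ ‖y‖ := by
    calc _ ≤ ‖P‖ * ‖y‖ := norm_mul_le _ _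
      _ ≤ 1 * ‖y‖ := by gcongr; exact hP.norm_le
      _ = _ := one_mul _
  have hlow := hP.add_norm_sq_le hP0 (by positivity) hvv hvy
  have hup := hP.norm_sq_le hδ hvv hvy hc
  have : δ * ‖P * y‖ ^ 2 ≤ δ * ‖y‖ ^ 2 := by gcongr
  rw [hX, norm_one, ← hPy, abs_le]
  constructor
  · have : 0 ≤ δ * ‖y‖ ^ 2 := by positivity
    linarith
  · linarith

end Blocks

end CStarMatrix

/-! ### Transfer to the norm of `M_n(A)`. -/

section MatrixCStarNorm

variable {A : Type*} [CStarAlgebra A]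

lemma matrixCStarNorm_nonneg {n : ℕ} (M : Matrix (Fin n) (Fin n) A) : 0 ≤ matrixCStarNorm M := by
  let _ : PartialOrder A := CStarAlgebra.spectralOrder A
  let _ : StarOrderedRing A := CStarAlgebra.spectralOrderedRing A
  exact norm_nonneg (CStarMatrix.ofMatrix M)

lemma matrixCStarNorm_one_by_one (M : Matrix (Fin 1) (Fin 1) A) :
    matrixCStarNorm M = ‖M 0 0‖ := by
  let _ : PartialOrder A := CStarAlgebra.spectralOrder A
  let _ : StarOrderedRing A := CStarAlgebra.spectralOrderedRing A
  let φ : A →⋆ₙₐ[ℂ] CStarMatrix (Fin 1) (Fin 1) A :=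
    { toFun := fun a ↦ CStarMatrix.ofMatrix (Matrix.of fun _ _ ↦ a)
      map_smul' := fun _ _ ↦ rfl
      map_zero' := rfl
      map_add' := fun _ _ ↦ rfl
      map_mul' := fun a b ↦ by ext i j; simp [CStarMatrix.mul_apply]
      map_star' := fun _ ↦ rfl }
  have hφ : Function.Injective φ := fun a b hab ↦ congrFun (congrFun hab 0) 0
  rw [← NonUnitalStarAlgHom.norm_map φ hφ (M 0 0)]
  change ‖CStarMatrix.ofMatrix M‖ = _
  congr 1
  ext i j
  rw [Subsingleton.elim i 0, Subsingleton.elim j 0]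
  rfl

open CStarMatrix in
/-- The norm of `a + u b`, for a unitary `u`, is determined up to a small error by the norms of
block matrices whose entries are those of `a` and `b`, scalars, and scalar multiples of `u*`. -/
lemma matrixCStarNorm_add_mul_estimate {n : ℕ} (a b : Matrix (Fin n) (Fin n) A) {u : A}
    (hu : u ∈ unitary A) {c δ : ℝ} (hδ : 0 < δ)
    (hc : (1 + δ⁻¹) * matrixCStarNorm ((Matrix.fromBlocks a 0 b 0).reindex finSumFinEquiv
      finSumFinEquiv) ^ 2 ≤ 2 * c ^ 2) :
    |matrixCStarNorm ((Matrix.fromBlocks a (Matrix.diagonal fun _ ↦ (c : ℂ) • 1) b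
        (Matrix.diagonal fun _ ↦ (c : ℂ) • star u)).reindex finSumFinEquiv finSumFinEquiv) ^ 2
      - 2 * c ^ 2 * matrixCStarNorm (1 : Matrix (Fin n) (Fin n) A)
      - matrixCStarNorm (a + Matrix.diagonal (fun _ ↦ u) * b) ^ 2 / 2| ≤
    δ * matrixCStarNorm ((Matrix.fromBlocks a 0 b 0).reindex finSumFinEquiv
      finSumFinEquiv) ^ 2 := by
  let _ : PartialOrder A := CStarAlgebra.spectralOrder A
  let _ : StarOrderedRing A := CStarAlgebra.spectralOrderedRing A
  have hre : ∀ M : Matrix (Fin n ⊕ Fin n) (Fin n ⊕ Fin n) A,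
      matrixCStarNorm (M.reindex finSumFinEquiv finSumFinEquiv) = ‖ofMatrix M‖ := fun M ↦
    StarAlgEquiv.norm_map (reindexₐ ℂ A finSumFinEquiv) (ofMatrix M)
  set U : CStarMatrix (Fin n) (Fin n) A := ofMatrix (Matrix.diagonal fun _ ↦ u) with hU
  have hUs : star U = ofMatrix (Matrix.diagonal fun _ ↦ star u) :=
    Matrix.diagonal_conjTranspose _
  have hu1 : star u * u = 1 := (Unitary.mem_iff.mp hu).1
  have hu2 : u * star u = 1 := (Unitary.mem_iff.mp hu).2
  have hUu : U ∈ unitary (CStarMatrix (Fin n) (Fin n) A) := by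
    rw [Unitary.mem_iff, hUs]
    constructor
    · refine (Matrix.diagonal_mul_diagonal _ _).trans ?_
      simp only [hu1]
      exact Matrix.diagonal_one
    · refine (Matrix.diagonal_mul_diagonal _ _).trans ?_
      simp only [hu2]
      exact Matrix.diagonal_one
  rw [hre] at hc
  rw [hre, hre]
  have e1 : (c • 1 : CStarMatrix (Fin n) (Fin n) A) =
      ofMatrix (Matrix.diagonal fun _ ↦ (c : ℂ) • 1) := by
    ext i j
    by_cases h : i = j <;> simp [h]
  have e2 : c • star U = ofMatrix (Matrix.diagonal fun _ ↦ (c : ℂ) • star u) := by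
    ext i j
    rw [hUs]
    by_cases h : i = j <;> simp [h]
  have key := norm_blocks_estimate (a := ofMatrix a) (b := ofMatrix b) hUu hδ hc
  rw [e1, e2] at key
  exact key

end MatrixCStarNorm

/-! ### Propagating continuity from degree one to all `*`-polynomials. -/

namespace StarPoly

variable {d : ℕ}

lemma ι_mem_degreeLE_one (g : Fin d ⊕ Fin d) : FreeAlgebra.ι ℂ g ∈ degreeLE d 1 :=
  Submodule.subset_span ⟨[g], by simp, by simp⟩

lemma one_mem_degreeLE_one : (1 : StarPoly d) ∈ degreeLE d 1 :=
  Submodule.subset_span ⟨[], by simp, by simp⟩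

section Eval

variable {A : Type*} [CStarAlgebra A] (x : Fin d → A)

lemma eval_ι_swap (g : Fin d ⊕ Fin d) :
    eval x (FreeAlgebra.ι ℂ g.swap) = star (eval x (FreeAlgebra.ι ℂ g)) := by
  cases g <;> simp [eval]

lemma eval_ι_mem_unitary (hx : ∀ i, x i ∈ unitary A) (g : Fin d ⊕ Fin d) :
    eval x (FreeAlgebra.ι ℂ g) ∈ unitary A := by
  cases g with
  | inl i => simpa [eval] using hx i
  | inr i => simpa [eval] using Unitary.star_mem (hx i)

end Eval

variable {T : Type*} [TopologicalSpace T] {A : T → Type*} [∀ t, CStarAlgebra (A t)]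

/-- The norms of the evaluations at `ξ t` of matrices with entries in `V` are continuous in `t`
at `t₀`. -/
def NormContinuousAt (ξ : ∀ t, Fin d → A t) (t₀ : T) (V : Submodule ℂ (StarPoly d)) : Prop :=
  ∀ (n : ℕ) (p : Matrix (Fin n) (Fin n) (StarPoly d)), (∀ i j, p i j ∈ V) →
    ContinuousAt (fun t ↦ matrixCStarNorm (matEval (ξ t) p)) t₀

variable {ξ : ∀ t, Fin d → A t} {t₀ : T}

lemma continuousAt_of_forall_abs_sub_le {f : T → ℝ}
    (h : ∀ ε > 0, ∃ g : T → ℝ, ContinuousAt g t₀ ∧ ∀ᶠ t in 𝓝 t₀, |g t - f t| ≤ ε) :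
    ContinuousAt f t₀ := by
  rw [ContinuousAt, Metric.tendsto_nhds]
  intro ε hε
  obtain ⟨g, hg, hgf⟩ := h (ε / 4) (by positivity)
  filter_upwards [hgf, Metric.tendsto_nhds.mp hg (ε / 4) (by positivity)] with t h1 h2
  -- The approximation also holds at `t₀` itself; three errors of `ε / 4` then add up to less than
  -- `ε`.
  have h3 := hgf.self_of_nhds
  rw [Real.dist_eq] at h2 ⊢
  rw [abs_le] at h1 h3
  rw [abs_lt] at h2 ⊢
  constructor <;> linarith

lemma NormContinuousAt.sup_map_mulLeft_ι (hunitary : ∀ t i, ξ t i ∈ unitary (A t))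
    {V : Submodule ℂ (StarPoly d)} (hV : NormContinuousAt ξ t₀ V) (hV1 : degreeLE d 1 ≤ V)
    (g : Fin d ⊕ Fin d) :
    NormContinuousAt ξ t₀ (V ⊔ V.map (LinearMap.mulLeft ℂ (FreeAlgebra.ι ℂ g))) := by
  intro n q hq
  have hdec : ∀ i j, ∃ a ∈ V, ∃ b ∈ V, a + FreeAlgebra.ι ℂ g * b = q i j := fun i j ↦ by
    obtain ⟨a, ha, _, ⟨b, hb, rfl⟩, h⟩ := Submodule.mem_sup.mp (hq i j)
    exact ⟨a, ha, b, hb, h⟩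
  choose a ha b hb hab using hdec
  let a' : Matrix (Fin n) (Fin n) (StarPoly d) := Matrix.of a
  let b' : Matrix (Fin n) (Fin n) (StarPoly d) := Matrix.of b
  let y : Matrix (Fin (n + n)) (Fin (n + n)) (StarPoly d) :=
    (Matrix.fromBlocks a' 0 b' 0).reindex finSumFinEquiv finSumFinEquiv
  let z : ℝ → Matrix (Fin (n + n)) (Fin (n + n)) (StarPoly d) := fun c ↦
    (Matrix.fromBlocks a' (Matrix.diagonal fun _ ↦ (c : ℂ) • 1) b'
      (Matrix.diagonal fun _ ↦ (c : ℂ) • FreeAlgebra.ι ℂ g.swap)).reindex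
      finSumFinEquiv finSumFinEquiv
  have hdiag : ∀ {w : StarPoly d} (_ : w ∈ V) (i j : Fin n),
      Matrix.diagonal (fun _ ↦ w) i j ∈ V := fun {w} hw i j ↦ by
    by_cases h : i = j <;> simp [h, hw]
  have hyV : ∀ i j, y i j ∈ V := fun i j ↦ by
    change Matrix.fromBlocks a' 0 b' 0 (finSumFinEquiv.symm i) (finSumFinEquiv.symm j) ∈ V
    rcases finSumFinEquiv.symm i with i | i <;> rcases finSumFinEquiv.symm j with j | j
    exacts [ha i j, V.zero_mem, hb i j, V.zero_mem]
  have hzV : ∀ c i j, z c i j ∈ V := fun c i j ↦ by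
    change Matrix.fromBlocks a' _ b' _ (finSumFinEquiv.symm i) (finSumFinEquiv.symm j) ∈ V
    rcases finSumFinEquiv.symm i with i | i <;> rcases finSumFinEquiv.symm j with j | j
    exacts [ha i j, hdiag (V.smul_mem _ (hV1 one_mem_degreeLE_one)) i j, hb i j,
      hdiag (V.smul_mem _ (hV1 (ι_mem_degreeLE_one _))) i j]
  have h1V : ∀ i j, (1 : Matrix (Fin n) (Fin n) (StarPoly d)) i j ∈ V :=
    hdiag (hV1 one_mem_degreeLE_one)
  have hyt : ∀ t, matEval (ξ t) y = (Matrix.fromBlocks (matEval (ξ t) a') 0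
      (matEval (ξ t) b') 0).reindex finSumFinEquiv finSumFinEquiv := fun t ↦ by
    ext i j
    change eval (ξ t) (Matrix.fromBlocks a' 0 b' 0 (finSumFinEquiv.symm i)
      (finSumFinEquiv.symm j)) = Matrix.fromBlocks _ _ _ _ (finSumFinEquiv.symm i)
      (finSumFinEquiv.symm j)
    rcases finSumFinEquiv.symm i with i | i <;> rcases finSumFinEquiv.symm j with j | j <;>
      simp [matEval]
  have hzt : ∀ c t, matEval (ξ t) (z c) = (Matrix.fromBlocks (matEval (ξ t) a')
      (Matrix.diagonal fun _ ↦ (c : ℂ) • 1) (matEval (ξ t) b')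
      (Matrix.diagonal fun _ ↦ (c : ℂ) • star (eval (ξ t) (FreeAlgebra.ι ℂ g)))).reindex
      finSumFinEquiv finSumFinEquiv := fun c t ↦ by
    ext i j
    change eval (ξ t) (Matrix.fromBlocks a' _ b' _ (finSumFinEquiv.symm i)
      (finSumFinEquiv.symm j)) = Matrix.fromBlocks _ _ _ _ (finSumFinEquiv.symm i)
      (finSumFinEquiv.symm j)
    rcases finSumFinEquiv.symm i with i | i <;> rcases finSumFinEquiv.symm j with j | j <;>
      by_cases h : i = j <;> simp [matEval, h, eval_ι_swap, -Complex.coe_smul]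
  have h1t : ∀ t, matEval (ξ t) (1 : Matrix (Fin n) (Fin n) (StarPoly d)) = 1 := fun t ↦ by
    ext i j
    by_cases h : i = j <;> simp [matEval, Matrix.one_apply, h]
  have hqt : ∀ t, matEval (ξ t) q = matEval (ξ t) a' +
      Matrix.diagonal (fun _ ↦ eval (ξ t) (FreeAlgebra.ι ℂ g)) * matEval (ξ t) b' := fun t ↦ by
    ext i j
    simp [matEval, ← hab i j, a', b', Matrix.diagonal_mul]
  have hyc := hV _ y hyV
  -- A bound for `‖y(ξ t)‖` valid near `t₀`, so that `δ` and `c` can be chosen independently of `t`.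
  set K : ℝ := matrixCStarNorm (matEval (ξ t₀) y) + 1 with hK
  have hK0 : 0 < K := by
    have := matrixCStarNorm_nonneg (matEval (ξ t₀) y)
    linarith
  have hybd : ∀ᶠ t in 𝓝 t₀, matrixCStarNorm (matEval (ξ t) y) < K :=
    hyc.eventually_lt continuousAt_const (by linarith)
  have hsq : ContinuousAt (fun t ↦ matrixCStarNorm (matEval (ξ t) q) ^ 2 / 2) t₀ := by
    refine continuousAt_of_forall_abs_sub_le fun ε hε ↦ ?_
    set δ : ℝ := ε / K ^ 2 with hδ
    have hδ0 : 0 < δ := by positivity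
    set c : ℝ := √((1 + δ⁻¹) * K ^ 2) with hc
    have hc2 : c ^ 2 = (1 + δ⁻¹) * K ^ 2 := Real.sq_sqrt (by positivity)
    -- The norm of `1` may be `0` or `1` depending on `t`; it is continuous at `t₀` because `1 ∈ V`.
    refine ⟨fun t ↦ matrixCStarNorm (matEval (ξ t) (z c)) ^ 2
      - 2 * c ^ 2 * matrixCStarNorm (matEval (ξ t) (1 : Matrix (Fin n) (Fin n) (StarPoly d))),
      ((hV _ _ (hzV c)).pow 2).sub (continuousAt_const.mul (hV _ _ h1V)), ?_⟩
    filter_upwards [hybd] with t ht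
    have hy0 := matrixCStarNorm_nonneg (matEval (ξ t) y)
    have hyK : matrixCStarNorm (matEval (ξ t) y) ^ 2 ≤ K ^ 2 := by gcongr
    have hle : (1 + δ⁻¹) * matrixCStarNorm (matEval (ξ t) y) ^ 2 ≤ 2 * c ^ 2 := by
      have : (1 + δ⁻¹) * matrixCStarNorm (matEval (ξ t) y) ^ 2 ≤ (1 + δ⁻¹) * K ^ 2 := by gcongr
      have := sq_nonneg c
      linarith
    rw [hyt] at hle
    have key := matrixCStarNorm_add_mul_estimate _ _
      (eval_ι_mem_unitary (ξ t) (hunitary t) g) hδ0 hle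
    rw [← hyt, ← hzt, ← hqt, ← h1t t] at key
    refine key.trans ?_
    calc _ ≤ δ * K ^ 2 := by gcongr
      _ = ε := by rw [hδ]; field_simp
  have h := (hsq.const_mul 2).sqrt
  refine h.congr (Eventually.of_forall fun t ↦ ?_)
  change √(2 * (matrixCStarNorm (matEval (ξ t) q) ^ 2 / 2)) = _
  rw [mul_div_cancel₀ _ two_ne_zero, Real.sqrt_sq (matrixCStarNorm_nonneg _)]

/-- Quantifying over all `V` lets enlargements be chained: continuity over two spaces does not
directly give it over their sum, so the second factor or summand is treated over the space already
enlarged for the first. -/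
lemma NormContinuousAt.exists_mul_mem (hunitary : ∀ t i, ξ t i ∈ unitary (A t)) (p : StarPoly d) :
    ∀ V : Submodule ℂ (StarPoly d), NormContinuousAt ξ t₀ V → degreeLE d 1 ≤ V →
      ∃ V' : Submodule ℂ (StarPoly d), NormContinuousAt ξ t₀ V' ∧ V ≤ V' ∧
        ∀ v ∈ V, p * v ∈ V' := by
  induction p using FreeAlgebra.induction with
  | grade0 r =>
    refine fun V hV _ ↦ ⟨V, hV, le_rfl, fun v hv ↦ ?_⟩
    rw [← Algebra.smul_def]
    exact V.smul_mem r hv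
  | grade1 g =>
    exact fun V hV hV1 ↦ ⟨_, hV.sup_map_mulLeft_ι hunitary hV1 g, le_sup_left,
      fun v hv ↦ Submodule.mem_sup_right ⟨v, hv, rfl⟩⟩
  | add p q hp hq =>
    intro V hV hV1
    obtain ⟨V', hV', hle, hpV⟩ := hp V hV hV1
    obtain ⟨V'', hV'', hle', hqV⟩ := hq V' hV' (hV1.trans hle)
    refine ⟨V'', hV'', hle.trans hle', fun v hv ↦ ?_⟩
    rw [add_mul]
    exact V''.add_mem (hle' (hpV v hv)) (hqV v (hle hv))
  | mul p q hp hq =>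
    intro V hV hV1
    obtain ⟨V', hV', hle, hqV⟩ := hq V hV hV1
    obtain ⟨V'', hV'', hle', hpV⟩ := hp V' hV' (hV1.trans hle)
    refine ⟨V'', hV'', hle.trans hle', fun v hv ↦ ?_⟩
    rw [mul_assoc]
    exact hpV _ (hqV v hv)

lemma NormContinuousAt.exists_finset_subset (hunitary : ∀ t i, ξ t i ∈ unitary (A t))
    (h : NormContinuousAt ξ t₀ (degreeLE d 1)) (s : Finset (StarPoly d)) :
    ∃ V : Submodule ℂ (StarPoly d), NormContinuousAt ξ t₀ V ∧ degreeLE d 1 ≤ V ∧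
      ∀ p ∈ s, p ∈ V := by
  classical
  induction s using Finset.induction_on with
  | empty => exact ⟨_, h, le_rfl, by simp⟩
  | insert p s _ ih =>
    obtain ⟨V, hV, hV1, hs⟩ := ih
    obtain ⟨V', hV', hle, hp⟩ := NormContinuousAt.exists_mul_mem hunitary p V hV hV1
    refine ⟨V', hV', hV1.trans hle, fun q hq ↦ ?_⟩
    obtain rfl | hq := Finset.mem_insert.mp hq
    · simpa using hp 1 (hV1 one_mem_degreeLE_one)
    · exact hle (hs q hq)

end StarPoly

theorem mainTheorem6 {T : Type*} [MetricSpace T] (d : ℕ)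
    (A : T → Type*) [∀ t, CStarAlgebra (A t)]
    (ξ : ∀ t, Fin d → A t)
    (hgen : ∀ t, (StarAlgebra.adjoin ℂ (Set.range (ξ t))).topologicalClosure = ⊤)
    (hunitary : ∀ t i, ξ t i ∈ unitary (A t))
    (t₀ : T)
    (hlin : ∀ (n : ℕ) (p : Matrix (Fin n) (Fin n) (StarPoly d)),
      (∀ i j, p i j ∈ StarPoly.degreeLE d 1) →
        Tendsto (fun t => matrixCStarNorm (StarPoly.matEval (ξ t) p)) (𝓝 t₀)
          (𝓝 (matrixCStarNorm (StarPoly.matEval (ξ t₀) p)))) :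
    (∀ p : StarPoly d,
      Tendsto (fun t => ‖StarPoly.eval (ξ t) p‖) (𝓝 t₀) (𝓝 ‖StarPoly.eval (ξ t₀) p‖)) ∧
    (∀ (n : ℕ) (p : Matrix (Fin n) (Fin n) (StarPoly d)),
      Tendsto (fun t => matrixCStarNorm (StarPoly.matEval (ξ t) p)) (𝓝 t₀)
        (𝓝 (matrixCStarNorm (StarPoly.matEval (ξ t₀) p)))) := by
  classical
  have hmat : ∀ (n : ℕ) (p : Matrix (Fin n) (Fin n) (StarPoly d)),
      Tendsto (fun t => matrixCStarNorm (StarPoly.matEval (ξ t) p)) (𝓝 t₀)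
        (𝓝 (matrixCStarNorm (StarPoly.matEval (ξ t₀) p))) := fun n p ↦ by
    obtain ⟨V, hV, -, hp⟩ := StarPoly.NormContinuousAt.exists_finset_subset hunitary hlin
      (Finset.univ.image fun ij : Fin n × Fin n ↦ p ij.1 ij.2)
    exact hV n p fun i j ↦ hp _ (Finset.mem_image_of_mem _ (Finset.mem_univ (i, j)))
  refine ⟨fun p ↦ ?_, hmat⟩
  -- The scalar statement is the `1 × 1` case of the matrix one.
  have h := hmat 1 (Matrix.of fun _ _ ↦ p)
  simp only [matrixCStarNorm_one_by_one] at h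
  exact h
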